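/- Let $B=(B_t)_{t\ge 0}$ and $\tilde B=(\tilde B_t)_{t\ge 0}$ be independent real Brownian motions on a probability space $(\Omega,\mathscr F,\mathbb P)$, and let $X=(X_t)_{t\ge0}$ be a centered Gaussian process with continuous paths which is a Volterra process driven by $B$: $X_t=\int_0^T K(t,s)\,dB_s$ for all $T>0$, $t\in[0,T]$, where the kernel $K$ is square integrable on $[0,T]^2$ for every $T>0$, each $K(t,\cdot)$ is square integrable on bounded intervals, and $K(t,s)=0$ for $s>t$. Let $\alpha,\tilde\alpha\in\mathbb R$, $W=\alpha B+\tilde\alpha\tilde B$, and fix $T>0$. Let $(\mathbb P^\psi)_\psi$ be a regular conditional law on $C[0,\infty)$ of $X$ given the past $(W_t)_{t\in[0,T]}$; for a path $\psi$ on $[0,T]$ let $X^\psi$ denote a process with law $\mathbb P^\psi$, i.e. $X$ conditioned on $\{W_t=\psi_t,\ t\in[0,T]\}$. Let $\gamma_\varepsilon>0$ ($\varepsilon>0$) satisfy $\gamma_\varepsilon\to0$ as $\varepsilon\to0$, and suppose that there are constants $M,\tau,c,\hat\tau>0$ such that, for all sufficiently small $\varepsilon>0$, $$\sup_{s,t\in[0,1],\,s\ne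 t}\frac{\operatorname{Var}(X_{T+\varepsilon t}-X_{T+\varepsilon s})}{\gamma_\varepsilon^2\,|t-s|^{2\tau}}\le M$$ and $$\sup_{s,t\in[0,1],\,s\ne t}\frac{\varepsilon\int_0^t\bigl(K(T+\varepsilon t,T+\varepsilon u)-K(T+\varepsilon s,T+\varepsilon u)\bigr)^2du}{\gamma_\varepsilon^2\,|t-s|^{2\hat\tau}}\le c .$$ Then, for almost every $\psi$ (with respect to the law of $(W_t)_{t\in[0,T]}$), the family of processes $$U^{\varepsilon}=\bigl(X^\psi_{T+\varepsilon t}-X^\psi_T-\mathbb E[X^\psi_{T+\varepsilon t}-X^\psi_T]\bigr)_{t\in[0,1]},\qquad \varepsilon>0,$$ is exponentially tight in $C[0,1]$ at the inverse speed $\gamma_\varepsilon^2$: for every $R>0$ there is a compact set $\mathcal K_R\subset C[0,1]$ such that $$\limsup_{\varepsilon\to0}\ \gamma_\varepsilon^2\log\mathbb P\bigl(U^{\varepsilon}\notin\mathcal K_R\bigr)\le -R .$$ -/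

import Mathlib

open MeasureTheory ProbabilityTheory Filter Topology
open scoped NNReal ENNReal

/-- The step function `∑ₐ g(a) · 1_{(0,a]}` on the half-line. -/
noncomputable def stepFunction (g : ℝ≥0 →₀ ℝ) (u : ℝ) : ℝ :=
  g.sum fun a c => (Set.Ioc (0 : ℝ) a).indicator (fun _ => c) u

/-- The elementary integral `∑ₐ g(a) · B_a` of the step function `∑ₐ g(a) · 1_{(0,a]}`
against the process `B`. -/
noncomputable def stepIntegral {Ω : Type*} (B : ℝ≥0 → Ω → ℝ) (g : ℝ≥0 →₀ ℝ) (ω : Ω) : ℝ :=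
  g.sum fun a c => c * B a ω

/-- `Y = ∫₀ᵀ f(u) dB_u` almost surely (Wiener integral): `Y` is the limit in `L²(P)` of the
elementary integrals of step functions that converge to `f · 1_{[0,T]}` in `L²`. For a Brownian
motion `B` the elementary integral is an isometry, so that `Y` is unique up to `P`-null sets, and
it exists as soon as `f` is square integrable on `[0,T]`. -/
def IsWienerIntegral {Ω : Type*} [MeasurableSpace Ω] (P : Measure Ω) (B : ℝ≥0 → Ω → ℝ)
    (T : ℝ≥0) (f : ℝ → ℝ) (Y : Ω → ℝ) : Prop :=
  ∃ g : ℕ → (ℝ≥0 →₀ ℝ),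
    Tendsto (fun n => eLpNorm
      (fun u => (Set.Icc (0 : ℝ) T).indicator f u - stepFunction (g n) u) 2 volume)
      atTop (𝓝 0) ∧
    Tendsto (fun n => eLpNorm (fun ω => Y ω - stepIntegral B (g n) ω) 2 P) atTop (𝓝 0)

/-- Volterra kernels: `K` is square integrable on every square `[0,T]²`, every section `K(t,·)` is
square integrable (so that its Wiener integral makes sense for every `t`), and `K(t,s) = 0` for
`s > t`. Only the values on `[0,∞)²` matter. -/
structure IsVolterraKernel (K : ℝ → ℝ → ℝ) : Prop where
  memLp_square : ∀ T : ℝ, 0 < T →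
    MemLp (fun p : ℝ × ℝ => K p.1 p.2) 2 (volume.restrict (Set.Icc 0 T ×ˢ Set.Icc 0 T))
  memLp_section : ∀ T : ℝ, 0 < T → ∀ t ∈ Set.Icc (0 : ℝ) T,
    MemLp (K t) 2 (volume.restrict (Set.Icc 0 T))
  eq_zero_of_lt : ∀ t s : ℝ, 0 ≤ t → t < s → K t s = 0

/-- `X` is a continuous (Gaussian) Volterra process with kernel `K` driven by `B`: a centered
Gaussian process with `X_t = ∫₀ᵀ K(t,s) dB_s` for all `T > 0` and `t ∈ [0,T]`. -/
structure IsVolterraProcess {Ω : Type*} [MeasurableSpace Ω] (P : Measure Ω)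
    (B : ℝ≥0 → Ω → ℝ) (K : ℝ → ℝ → ℝ) (X : Ω → C(ℝ≥0, ℝ)) : Prop where
  kernel : IsVolterraKernel K
  gaussian : IsGaussianProcess (fun t ω => X ω t) P
  centered : ∀ t, ∫ ω, X ω t ∂P = 0
  representation : ∀ T : ℝ≥0, 0 < T → ∀ t ≤ T,
    IsWienerIntegral P B T (K t) (fun ω => X ω t)

/-- The mixed Brownian motion `W = α B + α' B'`, observed on the time interval `[0,T]`.
The σ-algebra that it generates is `σ(W_s : s ≤ T)`. -/
def mixedPast {Ω : Type*} (B B' : ℝ≥0 → Ω → ℝ) (α α' : ℝ) (T : ℝ≥0) (ω : Ω) :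
    Set.Iic T → ℝ :=
  fun s => α * B s ω + α' * B' s ω

/-- Under the law `Q` on path space, the centered rescaled increment
`x_{T+εt} - x_T - E_Q[x_{T+εt} - x_T]` of the path `x`, for `t ∈ [0,1]`. -/
noncomputable def centeredIncrement [MeasurableSpace C(ℝ≥0, ℝ)] (Q : Measure C(ℝ≥0, ℝ))
    (T ε : ℝ≥0) (x : C(ℝ≥0, ℝ)) (t : unitInterval) : ℝ :=
  x (T + ε * unitInterval.toNNReal t) - x T
    - ∫ y, (y (T + ε * unitInterval.toNNReal t) - y T) ∂Q

/-- Exponential tightness, as `ε → 0`, of the family `(U ε)_{ε > 0}` of processes indexed by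
`[0,1]`, at the inverse speed `η`. The event `U ε ∉ 𝒦` is that the path of `U ε` is not (the
underlying function of) an element of `𝒦 ⊆ C[0,1]`, so that discontinuous paths count as being
outside of `𝒦`. The logarithm is extended-real-valued, `log 0 = -∞`. -/
def IsExponentiallyTight {S : Type*} [MeasurableSpace S] (Q : Measure S)
    (U : ℝ≥0 → S → unitInterval → ℝ) (η : ℝ≥0 → ℝ) : Prop :=
  ∀ R : ℝ, 0 < R → ∃ 𝒦 : Set C(unitInterval, ℝ), IsCompact 𝒦 ∧
    limsup (fun ε : ℝ≥0 =>
      ((η ε : ℝ) : EReal) * ENNReal.log (Q {x | ¬ ∃ h ∈ 𝒦, ⇑h = U ε x})) (𝓝[>] 0)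
      ≤ ((-R : ℝ) : EReal)

/-- Hölder bound, at time `T`, for the variance of the increments of `X`, uniform in small `ε`:
`Var(X_{T+εt} - X_{T+εs}) / (γ_ε² |t-s|^{2τ}) ≤ M` for all `s ≠ t` in `[0,1]`. -/
def IncrementVarianceBound {Ω : Type*} [MeasurableSpace Ω] (P : Measure Ω)
    (X : Ω → C(ℝ≥0, ℝ)) (γ : ℝ≥0 → ℝ) (T : ℝ≥0) : Prop :=
  ∃ M τ : ℝ, 0 < M ∧ 0 < τ ∧ ∀ᶠ ε : ℝ≥0 in 𝓝[>] 0, ∀ s t : unitInterval, s ≠ t →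
    variance (fun ω => X ω (T + ε * unitInterval.toNNReal t)
        - X ω (T + ε * unitInterval.toNNReal s)) P
      / (γ ε ^ 2 * |(t : ℝ) - s| ^ (2 * τ)) ≤ M

/-- Hölder bound, at time `T`, for the kernel after time `T`, uniform in small `ε`:
`ε ∫₀ᵗ (K(T+εt, T+εu) - K(T+εs, T+εu))² du / (γ_ε² |t-s|^{2τ}) ≤ c` for all `s ≠ t` in `[0,1]`. -/
def KernelIncrementBound (K : ℝ → ℝ → ℝ) (γ : ℝ≥0 → ℝ) (T : ℝ≥0) : Prop :=
  ∃ c τ : ℝ, 0 < c ∧ 0 < τ ∧ ∀ᶠ ε : ℝ≥0 in 𝓝[>] 0, ∀ s t : unitInterval, s ≠ t →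
    (ε * ∫ u in (0 : ℝ)..t, (K (T + ε * t) (T + ε * u) - K (T + ε * s) (T + ε * u)) ^ 2)
      / (γ ε ^ 2 * |(t : ℝ) - s| ^ (2 * τ)) ≤ c

/-! Conditioning inside a Gaussian space can only lower variances. The closed span of all B_t and
B'_t in L²(P) consists of centered Gaussian variables and contains W_s and X_t. Projecting an
increment X_a - X_b onto the closed span of (W_s), s ≤ T, splits it into a function of W and an
orthogonal remainder, independent of W by joint Gaussianity
(`IsGaussianSpace.exists_decomposition`). So for almost every ψ the increment is Gaussian under P^ψ,
with variance at most Var(X_a - X_b).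

The exceptional null set depends on (a, b). The bound is therefore put on the exponential moments of
the difference of two independent copies (`SymmetrizedSubgaussian`): the unknown conditional mean
cancels, and Fatou's lemma carries the bound from a countable dense set of pairs to all pairs, since
paths and variances are continuous. Jensen's inequality then gives Gaussian tails around the
conditional mean. The same tails make that mean continuous in time, so U^ε has continuous paths.

The rest is chaining. By the variance bound, an increment of U^ε over a dyadic step 2^(-n) exceeds a
with probability at most 2 exp(-a² / (4 M γ² 2^(-2τn))). For a = r 2^(-τn/2) with r² = 4MR the
exponent is -(R/γ²) 2^(τn), and summing over n and the 2^n steps gives O(exp(-R/γ²)). Off this event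
the path has a fixed geometric modulus of continuity, and such paths form a compact set by
Arzelà–Ascoli. -/

/-! ### Gaussian Hilbert spaces and conditioning by projection. -/

section GaussianSpace

variable {Ω : Type*} [MeasurableSpace Ω] {P : Measure Ω}

/-- A Gaussian Hilbert space: a subspace of `L²(P)` all of whose elements are centered Gaussian. -/
def IsGaussianSpace (P : Measure Ω) (H : Submodule ℝ (Lp ℝ 2 P)) : Prop :=
  ∀ Y ∈ H, P.map Y = gaussianReal 0 (‖Y‖₊ ^ 2)

theorem Lp_two_integral_sq (Y : Lp ℝ 2 P) : ∫ ω, Y ω ^ 2 ∂P = ‖Y‖ ^ 2 := by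
  rw [← real_inner_self_eq_norm_sq, L2.inner_def]
  exact integral_congr_ae (ae_of_all _ fun ω => by simp [pow_two])

theorem map_eq_gaussianReal_nnnorm {Y : Lp ℝ 2 P} (h : HasGaussianLaw Y P)
    (h0 : ∫ ω, Y ω ∂P = 0) : P.map Y = gaussianReal 0 (‖Y‖₊ ^ 2) := by
  rw [h.map_eq_gaussianReal, h0, variance_of_integral_eq_zero h.aemeasurable h0,
    Lp_two_integral_sq]
  congr 1
  apply NNReal.eq
  rw [Real.coe_toNNReal _ (by positivity)]
  rfl

theorem IsGaussianSpace.hasGaussianLaw {H : Submodule ℝ (Lp ℝ 2 P)} (hH : IsGaussianSpace P H)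
    {Y : Lp ℝ 2 P} (hY : Y ∈ H) : HasGaussianLaw Y P :=
  ⟨by rw [hH Y hY]; infer_instance⟩

theorem IsGaussianSpace.integral_eq_zero {H : Submodule ℝ (Lp ℝ 2 P)} (hH : IsGaussianSpace P H)
    {Y : Lp ℝ 2 P} (hY : Y ∈ H) : ∫ ω, Y ω ∂P = 0 := by
  have h := integral_map (hH.hasGaussianLaw hY).aemeasurable (f := fun x : ℝ => x)
    (by fun_prop)
  rw [← h, hH Y hY]
  exact integral_id_gaussianReal

theorem charFun_map_eq_integral {Y : Ω → ℝ} (hY : AEMeasurable Y P) (θ : ℝ) :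
    charFun (P.map Y) θ = ∫ ω, Complex.exp (θ * Y ω * Complex.I) ∂P := by
  rw [charFun_apply_real, integral_map hY (by fun_prop)]

/-- The closure of a Gaussian Hilbert space is one. -/
theorem IsGaussianSpace.topologicalClosure [IsProbabilityMeasure P]
    {H : Submodule ℝ (Lp ℝ 2 P)} (hH : IsGaussianSpace P H) :
    IsGaussianSpace P H.topologicalClosure := by
  intro Y hY
  obtain ⟨y, hyH, hy⟩ := mem_closure_iff_seq_limit.1
    (show Y ∈ closure (H : Set (Lp ℝ 2 P)) from hY)
  obtain ⟨ns, hns, hae⟩ := (tendstoInMeasure_of_tendsto_Lp hy).exists_seq_tendsto_ae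
  have hm (Z : Lp ℝ 2 P) : AEMeasurable Z P := (Lp.aestronglyMeasurable Z).aemeasurable
  have : IsProbabilityMeasure (P.map Y) := Measure.isProbabilityMeasure_map (hm Y)
  -- Characteristic functions converge by dominated convergence along the a.e. convergent
  -- subsequence; the Gaussian side converges because the variance is the squared norm.
  refine Measure.ext_of_charFun (funext fun θ => ?_)
  have h1 : Tendsto (fun n => charFun (P.map (y (ns n))) θ) atTop (𝓝 (charFun (P.map Y) θ)) := by
    simp_rw [charFun_map_eq_integral (hm _)]
    refine tendsto_integral_of_dominated_convergence (fun _ => 1) (fun n => ?_)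
      (integrable_const _) (fun n => ae_of_all _ fun ω => ?_) ?_
    · have := hm (y (ns n))
      exact AEMeasurable.aestronglyMeasurable (by fun_prop)
    · rw [← Complex.ofReal_mul, Complex.norm_exp_ofReal_mul_I]
    · filter_upwards [hae] with ω hω
      have hc : Continuous fun x : ℝ => Complex.exp (θ * x * Complex.I) := by fun_prop
      exact (hc.tendsto _).comp hω
  have h2 : Tendsto (fun n => charFun (P.map (y (ns n))) θ) atTop
      (𝓝 (charFun (gaussianReal 0 (‖Y‖₊ ^ 2)) θ)) := by
    simp_rw [hH _ (hyH _), charFun_gaussianReal]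
    have hc : Continuous fun Z : Lp ℝ 2 P => Complex.exp (θ * ((0 : ℝ) : ℂ) * Complex.I
        - ((‖Z‖₊ ^ 2 : ℝ≥0) : ℝ) * θ ^ 2 / 2) := by fun_prop
    exact (hc.tendsto Y).comp (hy.comp hns.tendsto_atTop)
  exact tendsto_nhds_unique h1 h2

/-- Processes with values in a Gaussian Hilbert space are Gaussian processes. -/
theorem IsGaussianSpace.isGaussianProcess [IsProbabilityMeasure P]
    {H : Submodule ℝ (Lp ℝ 2 P)} (hH : IsGaussianSpace P H) {ι : Type*} {Y : ι → Ω → ℝ}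
    (Z : ι → Lp ℝ 2 P) (hZ : ∀ i, Z i ∈ H) (hYZ : ∀ i, Z i =ᵐ[P] Y i) :
    IsGaussianProcess Y P := by
  refine IsGaussianProcess.congr (X := fun i => Z i) ⟨fun I => ⟨?_⟩⟩ hYZ
  refine isGaussian_of_map_eq_gaussianReal fun L => ?_
  have hm : AEMeasurable (fun ω => I.restrict fun i => Z i ω) P :=
    aemeasurable_pi_lambda _ fun i => (Lp.aestronglyMeasurable (Z i)).aemeasurable
  classical
  -- Cramér–Wold: a linear functional of finitely many coordinates is again an element of `H`, hence
  -- Gaussian.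
  let W : Lp ℝ 2 P := ∑ i : I, L (Pi.single i 1) • Z i
  have hW : W ∈ H := Submodule.sum_mem _ fun i _ => Submodule.smul_mem _ _ (hZ i)
  refine ⟨0, ‖W‖₊ ^ 2, ?_⟩
  rw [← hH W hW, AEMeasurable.map_map_of_aemeasurable (by fun_prop) hm]
  refine Measure.map_congr ?_
  have h1 : W =ᵐ[P] fun ω => ∑ i : I, (L (Pi.single i 1) • Z i : Lp ℝ 2 P) ω := by
    exact Lp.coeFn_fun_finsetSum Finset.univ
      (fun i : I => (L (Pi.single i 1) • Z i : Lp ℝ 2 P))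
  have h2 : ∀ᵐ ω ∂P, ∀ i : I, (L (Pi.single i 1) • Z i : Lp ℝ 2 P) ω
      = L (Pi.single i 1) * Z i ω := by
    rw [ae_all_iff]
    intro i
    filter_upwards [Lp.coeFn_smul (L (Pi.single i 1)) (Z i)] with ω hω
    simpa using hω
  filter_upwards [h1, h2] with ω h1 h2
  rw [h1]
  simp_rw [h2]
  simp only [Function.comp_apply]
  conv_lhs => rw [← Finset.univ_sum_single (I.restrict fun i => Z i ω)]
  rw [map_sum]
  refine Finset.sum_congr rfl fun i _ => ?_
  have : Pi.single i (I.restrict (fun i => Z i ω) i)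
      = (Z i ω) • (Pi.single i 1 : I → ℝ) := by
    rw [← Pi.single_smul]; simp
  rw [this, map_smul, smul_eq_mul, mul_comm]

theorem coeFn_finsupp_sum_smul {ι : Type*} {Y : ι → Ω → ℝ} {Z : ι → Lp ℝ 2 P}
    (hZ : ∀ i, Z i =ᵐ[P] Y i) (c : ι →₀ ℝ) :
    (c.sum fun i a => a • Z i : Lp ℝ 2 P) =ᵐ[P] fun ω => c.sum fun i a => a * Y i ω := by
  have h1 : (c.sum fun i a => a • Z i : Lp ℝ 2 P) =ᵐ[P]
      fun ω => ∑ i ∈ c.support, (c i • Z i : Lp ℝ 2 P) ω :=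
    Lp.coeFn_fun_finsetSum c.support (fun i => (c i • Z i : Lp ℝ 2 P))
  have h2 : ∀ᵐ ω ∂P, ∀ i ∈ c.support, (c i • Z i : Lp ℝ 2 P) ω = c i * Y i ω := by
    refine (ae_ball_iff c.support.countable_toSet).2 fun i _ => ?_
    filter_upwards [Lp.coeFn_smul (c i) (Z i), hZ i] with ω hω hi
    rw [hω, Pi.smul_apply, hi, smul_eq_mul]
  filter_upwards [h1, h2] with ω h1 h2
  rw [h1]
  exact Finset.sum_congr rfl h2

theorem hasGaussianLaw_finsupp_sum {ι : Type*} {Y : ι → Ω → ℝ} (hY : IsGaussianProcess Y P)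
    (c : ι →₀ ℝ) : HasGaussianLaw (fun ω => c.sum fun i a => a * Y i ω) P :=
  (hY.smul c).hasGaussianLaw_fun_sum (I := c.support)

theorem integral_finsupp_sum_eq_zero {ι : Type*} {Y : ι → Ω → ℝ} (hY : IsGaussianProcess Y P)
    (h0 : ∀ i, ∫ ω, Y i ω ∂P = 0) (c : ι →₀ ℝ) :
    ∫ ω, (c.sum fun i a => a * Y i ω) ∂P = 0 := by
  simp only [Finsupp.sum]
  rw [integral_finsetSum _ fun i _ => (hY.hasGaussianLaw_eval i).integrable.const_mul _]
  simp [integral_const_mul, h0]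

/-- Two independent centered Gaussian processes together span a Gaussian Hilbert space. -/
theorem isGaussianSpace_span_sup_span {ι ι' : Type*} {Y : ι → Ω → ℝ} {Y' : ι' → Ω → ℝ}
    (hY : IsGaussianProcess Y P) (hY' : IsGaussianProcess Y' P)
    (h0 : ∀ i, ∫ ω, Y i ω ∂P = 0) (h0' : ∀ i, ∫ ω, Y' i ω ∂P = 0)
    (hind : IndepFun (fun ω i => Y i ω) (fun ω i => Y' i ω) P)
    {Z : ι → Lp ℝ 2 P} {Z' : ι' → Lp ℝ 2 P}
    (hZ : ∀ i, Z i =ᵐ[P] Y i) (hZ' : ∀ i, Z' i =ᵐ[P] Y' i) :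
    IsGaussianSpace P (Submodule.span ℝ (Set.range Z) ⊔ Submodule.span ℝ (Set.range Z')) := by
  intro V hV
  obtain ⟨v, hv, v', hv', rfl⟩ := Submodule.mem_sup.1 hV
  obtain ⟨c, rfl⟩ := Finsupp.mem_span_range_iff_exists_finsupp.1 hv
  obtain ⟨c', rfl⟩ := Finsupp.mem_span_range_iff_exists_finsupp.1 hv'
  have hae : ((c.sum fun i a => a • Z i) + (c'.sum fun i a => a • Z' i) : Lp ℝ 2 P) =ᵐ[P]
      fun ω => (c.sum fun i a => a * Y i ω) + (c'.sum fun i a => a * Y' i ω) := by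
    filter_upwards [Lp.coeFn_add (c.sum fun i a => a • Z i) (c'.sum fun i a => a • Z' i),
      coeFn_finsupp_sum_smul hZ c, coeFn_finsupp_sum_smul hZ' c'] with ω h1 h2 h3
    rw [h1, Pi.add_apply, h2, h3]
  have hi : IndepFun (fun ω => c.sum fun i a => a * Y i ω)
      (fun ω => c'.sum fun i a => a * Y' i ω) P :=
    hind.comp (φ := fun y : ι → ℝ => c.sum fun i a => a * y i)
      (ψ := fun y : ι' → ℝ => c'.sum fun i a => a * y i)
      (Finset.measurable_sum _ fun i _ => (measurable_pi_apply i).const_mul _)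
      (Finset.measurable_sum _ fun i _ => (measurable_pi_apply i).const_mul _)
  have hg := hasGaussianLaw_finsupp_sum hY c
  have hg' := hasGaussianLaw_finsupp_sum hY' c'
  refine map_eq_gaussianReal_nnnorm ((hi.hasGaussianLaw hg hg').fun_add.congr hae.symm) ?_
  rw [integral_congr_ae hae, integral_add hg.integrable hg'.integrable,
    integral_finsupp_sum_eq_zero hY h0, integral_finsupp_sum_eq_zero hY' h0', add_zero]

/-- Elements of the closed span of the coordinates of `V` are functions of `V`. -/
theorem exists_measurable_comp_of_mem_closure_span {ι 𝓧 : Type*} [MeasurableSpace 𝓧]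
    {V : Ω → 𝓧} (hV : Measurable V) {e : ι → 𝓧 → ℝ} (he : ∀ i, Measurable (e i))
    {Z : ι → Lp ℝ 2 P} (hZ : ∀ i, Z i =ᵐ[P] fun ω => e i (V ω)) {Y : Lp ℝ 2 P}
    (hY : Y ∈ (Submodule.span ℝ (Set.range Z)).topologicalClosure) :
    ∃ f : 𝓧 → ℝ, Measurable f ∧ Y =ᵐ[P] fun ω => f (V ω) := by
  -- Composition with `V` is a linear isometry from L² of the law of `V` into L²(P), so its range is
  -- closed; containing every `Z i`, it contains their closed span.
  let Φ := Lp.compMeasurePreservingₗᵢ (E := ℝ) (p := 2) ℝ V (hV.measurePreserving P)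
  have hle : (Submodule.span ℝ (Set.range Z)).topologicalClosure ≤ LinearMap.range Φ.toLinearMap := by
    refine Submodule.topologicalClosure_minimal _ (Submodule.span_le.2 ?_) ?_
    · rintro _ ⟨i, rfl⟩
      have hm : MemLp (e i) 2 (P.map V) := by
        rw [memLp_map_measure_iff (he i).aestronglyMeasurable hV.aemeasurable]
        exact (memLp_congr_ae (hZ i)).1 (Lp.memLp (Z i))
      refine ⟨hm.toLp _, Lp.ext ?_⟩
      refine (Lp.coeFn_compMeasurePreserving (hm.toLp _) (hV.measurePreserving P)).trans ?_
      exact ((hV.measurePreserving P).quasiMeasurePreserving.ae_eq_comp hm.coeFn_toLp).trans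
        (hZ i).symm
    · have := Φ.isometry.isClosedEmbedding.isClosed_range
      convert! this
  obtain ⟨g, hg⟩ := hle hY
  have hgm : StronglyMeasurable ((Lp.aestronglyMeasurable g).mk g) :=
    (Lp.aestronglyMeasurable g).stronglyMeasurable_mk
  refine ⟨_, hgm.measurable, ?_⟩
  rw [← hg]
  refine (Lp.coeFn_compMeasurePreserving g (hV.measurePreserving P)).trans ?_
  exact (hV.measurePreserving P).quasiMeasurePreserving.ae_eq_comp
    (Lp.aestronglyMeasurable g).ae_eq_mk

/-- In a Gaussian Hilbert space, every element is the sum of a function of the observation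
`(V_i)_i` and of an independent centered Gaussian variable of smaller variance. -/
theorem IsGaussianSpace.exists_decomposition [IsProbabilityMeasure P]
    {H : Submodule ℝ (Lp ℝ 2 P)} (hH : IsGaussianSpace P H) (hHc : IsClosed (H : Set (Lp ℝ 2 P)))
    {ι : Type*} {V : Ω → ι → ℝ} (hV : Measurable V) {Z : ι → Lp ℝ 2 P} (hZH : ∀ i, Z i ∈ H)
    (hZ : ∀ i, Z i =ᵐ[P] fun ω => V ω i) {Y : Lp ℝ 2 P} (hY : Y ∈ H) :
    ∃ f : (ι → ℝ) → ℝ, Measurable f ∧ ∃ v : ℝ≥0, v ≤ ‖Y‖₊ ^ 2 ∧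
      P.map (fun ω => Y ω - f (V ω)) = gaussianReal 0 v ∧
      IndepFun V (fun ω => Y ω - f (V ω)) P := by
  let M := (Submodule.span ℝ (Set.range Z)).topologicalClosure
  have hMH : M ≤ H := Submodule.topologicalClosure_minimal _
    (Submodule.span_le.2 (by rintro _ ⟨i, rfl⟩; exact hZH i)) hHc
  have : CompleteSpace M := (Submodule.isClosed_topologicalClosure _).completeSpace_coe
  let N : Lp ℝ 2 P := Y - M.starProjection Y
  have hYM : M.starProjection Y ∈ M := Submodule.starProjection_apply_mem _ _
  have hN : N ∈ H := H.sub_mem hY (hMH hYM)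
  have hNorth : N ∈ Mᗮ := Submodule.sub_starProjection_mem_orthogonal Y
  obtain ⟨f, hf, hfY⟩ := exists_measurable_comp_of_mem_closure_span hV
    (fun i => measurable_pi_apply i) hZ hYM
  have hNf : N =ᵐ[P] fun ω => Y ω - f (V ω) := by
    filter_upwards [Lp.coeFn_sub Y (M.starProjection Y), hfY] with ω h1 h2
    rw [h1, Pi.sub_apply, h2]
  refine ⟨f, hf, ‖N‖₊ ^ 2, ?_, ?_, ?_⟩
  · have h1 : ‖Y‖ ^ 2 = ‖M.starProjection Y‖ ^ 2 + ‖N‖ ^ 2 := by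
      have h := norm_add_sq_eq_norm_sq_add_norm_sq_of_inner_eq_zero
        (M.starProjection Y) N (Submodule.inner_right_of_mem_orthogonal hYM hNorth)
      have h' : M.starProjection Y + N = Y := by simp [N]
      rw [h'] at h
      simpa only [pow_two] using h
    rw [← NNReal.coe_le_coe]
    push_cast
    rw [h1]
    have := sq_nonneg ‖M.starProjection Y‖
    linarith
  · rw [← Measure.map_congr hNf]
    exact hH N hN
  -- The remainder is adjoined to the observation as one Gaussian process, where zero covariance
  -- means independence.
  · have hproc : IsGaussianProcess (Sum.elim (fun i ω => V ω i) fun (_ : Unit) => N) P :=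
      hH.isGaussianProcess (Sum.elim Z fun _ => N) (by rintro (i | i); exacts [hZH i, hN])
        (by rintro (i | i); exacts [hZ i, ae_eq_refl _])
    have hmN : AEMeasurable N P := (Lp.aestronglyMeasurable N).aemeasurable
    have hmV (i : ι) : AEMeasurable (fun ω => V ω i) P :=
      ((measurable_pi_apply i).comp hV).aemeasurable
    have hcov (i : ι) : cov[fun ω => V ω i, N; P] = 0 := by
      have hVi : MemLp (fun ω => V ω i) 2 P := (memLp_congr_ae (hZ i)).1 (Lp.memLp (Z i))
      rw [covariance_eq_sub hVi (Lp.memLp N), hH.integral_eq_zero hN, mul_zero, sub_zero]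
      have h := Submodule.inner_right_of_mem_orthogonal
        (Submodule.le_topologicalClosure _ (Submodule.subset_span ⟨i, rfl⟩) : Z i ∈ M) hNorth
      rw [L2.inner_def] at h
      rw [← h]
      refine integral_congr_ae ?_
      filter_upwards [hZ i] with ω hω
      simp [hω, mul_comm]
    have h := hproc.indepFun_of_covariance_eq_zero hmV (fun _ => hmN) (fun i _ => hcov i)
    have h' := h.comp (φ := id) (ψ := fun x : Unit → ℝ => x ()) measurable_id
      (show Measurable fun x : Unit → ℝ => x () from measurable_pi_apply (X := fun _ => ℝ) ())
    exact h'.congr (ae_eq_refl _) hNf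

end GaussianSpace

/-- If `φ(X) - f(V)` is independent of `V`, then its law is the conditional law of
`φ(X) - f(V)` given `V`. -/
theorem ProbabilityTheory.HasCondDistrib.map_sub_ae_eq {Ω 𝓧 𝓨 : Type*} [MeasurableSpace Ω] [MeasurableSpace 𝓧]
    [MeasurableSpace 𝓨] {P : Measure Ω} [IsProbabilityMeasure P] {X : Ω → 𝓨} {V : Ω → 𝓧}
    {κ : Kernel 𝓧 𝓨} [IsMarkovKernel κ] (hκ : HasCondDistrib X V κ P) {φ : 𝓨 → ℝ}
    (hφ : Measurable φ) {f : 𝓧 → ℝ} (hf : Measurable f)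
    (hind : IndepFun V (fun ω => φ (X ω) - f (V ω)) P) :
    ∀ᵐ ψ ∂(P.map V), (κ ψ).map (fun x => φ x - f ψ) = P.map (fun ω => φ (X ω) - f (V ω)) := by
  have hV : AEMeasurable V P := hκ.aemeasurable_fst
  have hX : AEMeasurable X P := hκ.aemeasurable_snd
  have hm : AEMeasurable (fun ω => φ (X ω) - f (V ω)) P := by fun_prop
  let g : 𝓧 × 𝓨 → ℝ := fun p => φ p.2 - f p.1
  have hg : Measurable g := by fun_prop
  let η : Kernel 𝓧 ℝ := (Kernel.id ×ₖ κ).map g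
  have : IsMarkovKernel η := Kernel.IsMarkovKernel.map _ hg
  have hη (ψ : 𝓧) : η ψ = (κ ψ).map (fun x => φ x - f ψ) := by
    rw [Kernel.map_apply _ hg, Kernel.prod_apply, Kernel.id_apply, Measure.dirac_prod,
      Measure.map_map hg measurable_prodMk_left]
    rfl
  have : IsProbabilityMeasure (P.map V) := Measure.isProbabilityMeasure_map hV
  have : IsProbabilityMeasure (P.map fun ω => φ (X ω) - f (V ω)) :=
    Measure.isProbabilityMeasure_map hm
  -- Both sides are the joint law of `V` and the remainder: one obtained from `κ`, the other from
  -- independence. Disintegrations agree almost everywhere.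
  have key : P.map V ⊗ₘ η = P.map V ⊗ₘ Kernel.const 𝓧 (P.map fun ω => φ (X ω) - f (V ω)) := by
    rw [Measure.compProd_const,
      ← (indepFun_iff_map_prod_eq_prod_map_map hV hm).1 hind]
    have h1 : P.map (fun ω => (V ω, φ (X ω) - f (V ω)))
        = (P.map V ⊗ₘ κ).map (fun p => (p.1, g p)) := by
      rw [← hκ.map_eq, AEMeasurable.map_map_of_aemeasurable (by fun_prop) (by fun_prop)]
      rfl
    rw [h1]
    ext s hs
    rw [Measure.map_apply (by fun_prop) hs, Measure.compProd_apply hs,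
      Measure.compProd_apply (by exact (by fun_prop : Measurable fun p => (p.1, g p)) hs)]
    refine lintegral_congr fun ψ => ?_
    rw [hη, Measure.map_apply (by fun_prop) (measurable_prodMk_left hs)]
    rfl
  filter_upwards [Kernel.ae_eq_of_compProd_eq key] with ψ hψ
  rw [← hη, hψ, Kernel.const_apply]

/-! ### Sub-Gaussian bounds insensitive to centering. -/

section Symmetrization

variable {S : Type*} [MeasurableSpace S] {Q : Measure S}

/-- The exponential moments of the difference of two independent copies of `φ` are those of a
centered random variable with variance proxy `2 w`. -/
def SymmetrizedSubgaussian (Q : Measure S) (φ : S → ℝ) (w : ℝ) : Prop :=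
  ∀ l : ℝ, ∫⁻ p, ENNReal.ofReal (Real.exp (l * (φ p.1 - φ p.2))) ∂(Q.prod Q)
    ≤ ENNReal.ofReal (Real.exp (l ^ 2 * w))

theorem lintegral_exp_of_map_eq_gaussianReal {φ : S → ℝ} (hφ : Measurable φ) {v : ℝ≥0}
    (h : Q.map φ = gaussianReal 0 v) (l : ℝ) :
    ∫⁻ x, ENNReal.ofReal (Real.exp (l * φ x)) ∂Q
      = ENNReal.ofReal (Real.exp (v * l ^ 2 / 2)) := by
  have hint : Integrable (fun x => Real.exp (l * φ x)) Q := by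
    have := integrable_exp_mul_gaussianReal (μ := 0) (v := v) l
    rw [← h] at this
    exact this.comp_measurable hφ
  rw [← ofReal_integral_eq_lintegral_ofReal hint (ae_of_all _ fun _ => (Real.exp_pos _).le)]
  have := mgf_gaussianReal h l
  rw [mgf, zero_mul, zero_add] at this
  rw [this]

theorem measure_lt_le_of_lintegral_exp_le {ξ : S → ℝ} (hξ : Measurable ξ) {w : ℝ} (hw : 0 < w)
    (h : ∀ l : ℝ, ∫⁻ x, ENNReal.ofReal (Real.exp (l * ξ x)) ∂Q
      ≤ ENNReal.ofReal (Real.exp (l ^ 2 * w))) {a : ℝ} (ha : 0 ≤ a) :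
    Q {x | a < ξ x} ≤ ENNReal.ofReal (Real.exp (-a ^ 2 / (4 * w))) := by
  -- Chernoff's bound at the minimiser of -l a + l² w.
  set l := a / (2 * w)
  have hl : 0 ≤ l := by positivity
  have h1 : ENNReal.ofReal (Real.exp (l * a)) * Q {x | a < ξ x}
      ≤ ENNReal.ofReal (Real.exp (l ^ 2 * w)) := by
    refine le_trans ?_ (h l)
    refine le_trans ?_ (mul_meas_ge_le_lintegral₀ (by fun_prop) (ENNReal.ofReal (Real.exp (l * a))))
    gcongr
    intro hx
    exact ENNReal.ofReal_le_ofReal (Real.exp_le_exp.2 (mul_le_mul_of_nonneg_left hx.le hl))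
  have h2 : Q {x | a < ξ x} = ENNReal.ofReal (Real.exp (-(l * a)))
      * (ENNReal.ofReal (Real.exp (l * a)) * Q {x | a < ξ x}) := by
    rw [← mul_assoc, ← ENNReal.ofReal_mul (Real.exp_pos _).le, ← Real.exp_add]
    simp
  rw [h2]
  calc _ ≤ ENNReal.ofReal (Real.exp (-(l * a))) * ENNReal.ofReal (Real.exp (l ^ 2 * w)) := by gcongr
    _ = _ := by
      rw [← ENNReal.ofReal_mul (Real.exp_pos _).le, ← Real.exp_add]
      congr 2
      simp only [l]
      field_simp
      ring

/-- Fatou's lemma for symmetrized exponential moments. -/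
theorem SymmetrizedSubgaussian.of_tendsto {φ : ℕ → S → ℝ} {φ' : S → ℝ} {w : ℕ → ℝ} {w' : ℝ}
    (hm : ∀ n, Measurable (φ n)) (h : ∀ n, SymmetrizedSubgaussian Q (φ n) (w n))
    (hφ : ∀ x, Tendsto (fun n => φ n x) atTop (𝓝 (φ' x))) (hw : Tendsto w atTop (𝓝 w')) :
    SymmetrizedSubgaussian Q φ' w' := by
  intro l
  have h1 (p : S × S) : Tendsto (fun n => ENNReal.ofReal (Real.exp (l * (φ n p.1 - φ n p.2))))
      atTop (𝓝 (ENNReal.ofReal (Real.exp (l * (φ' p.1 - φ' p.2))))) :=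
    ENNReal.tendsto_ofReal ((Real.continuous_exp.tendsto _).comp
      (((hφ p.1).sub (hφ p.2)).const_mul l))
  have h2 : Tendsto (fun n => ENNReal.ofReal (Real.exp (l ^ 2 * w n))) atTop
      (𝓝 (ENNReal.ofReal (Real.exp (l ^ 2 * w')))) :=
    ENNReal.tendsto_ofReal ((Real.continuous_exp.tendsto _).comp (hw.const_mul _))
  calc ∫⁻ p, ENNReal.ofReal (Real.exp (l * (φ' p.1 - φ' p.2))) ∂(Q.prod Q)
      = ∫⁻ p, liminf (fun n => ENNReal.ofReal (Real.exp (l * (φ n p.1 - φ n p.2)))) atTop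
          ∂(Q.prod Q) := lintegral_congr fun p => (h1 p).liminf_eq.symm
    _ ≤ liminf (fun n => ∫⁻ p, ENNReal.ofReal (Real.exp (l * (φ n p.1 - φ n p.2))) ∂(Q.prod Q))
          atTop := lintegral_liminf_le fun n => by
            have := hm n
            fun_prop
    _ ≤ liminf (fun n => ENNReal.ofReal (Real.exp (l ^ 2 * w n))) atTop :=
          liminf_le_liminf (Eventually.of_forall fun n => h n l)
    _ = _ := h2.liminf_eq

variable [IsProbabilityMeasure Q]

/-- Any constant `c` cancels in the difference of the two copies, after which Tonelli factorises the
integral. -/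
theorem lintegral_exp_prod {φ : S → ℝ} (hφ : Measurable φ) (l c : ℝ) :
    ∫⁻ p, ENNReal.ofReal (Real.exp (l * (φ p.1 - φ p.2))) ∂(Q.prod Q)
      = (∫⁻ x, ENNReal.ofReal (Real.exp (l * (φ x - c))) ∂Q)
        * ∫⁻ y, ENNReal.ofReal (Real.exp (-l * (φ y - c))) ∂Q := by
  rw [← lintegral_prod_mul (by fun_prop) (by fun_prop)]
  refine lintegral_congr fun p => ?_
  rw [← ENNReal.ofReal_mul (Real.exp_pos _).le, ← Real.exp_add]
  ring_nf

/-- Each copy contributes v l² / 2 to the exponent. The centering `c`, which depends on the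
conditioning path, leaves no trace in the conclusion. -/
theorem symmetrizedSubgaussian_of_map_sub_eq {φ : S → ℝ} (hφ : Measurable φ) {v : ℝ≥0} {c w : ℝ}
    (hvw : v ≤ w) (h : Q.map (fun x => φ x - c) = gaussianReal 0 v) :
    SymmetrizedSubgaussian Q φ w := by
  intro l
  rw [lintegral_exp_prod hφ l c, lintegral_exp_of_map_eq_gaussianReal (by fun_prop) h,
    lintegral_exp_of_map_eq_gaussianReal (by fun_prop) h,
    ← ENNReal.ofReal_mul (Real.exp_pos _).le, ← Real.exp_add]
  refine ENNReal.ofReal_le_ofReal (Real.exp_le_exp.2 ?_)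
  nlinarith [sq_nonneg l]

/-- Since |y| ≤ e^y + e^(-y), the difference of the copies is integrable; by Fubini, freezing the
second copy at a suitable point leaves `φ` minus a constant. -/
theorem SymmetrizedSubgaussian.integrable {φ : S → ℝ} {w : ℝ} (h : SymmetrizedSubgaussian Q φ w)
    (hφ : Measurable φ) : Integrable φ Q := by
  have hexp (l : ℝ) : Integrable (fun p : S × S => Real.exp (l * (φ p.1 - φ p.2)))
      (Q.prod Q) := by
    refine ⟨by fun_prop, ?_⟩
    rw [hasFiniteIntegral_iff_ofReal (ae_of_all _ fun _ => (Real.exp_pos _).le)]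
    exact (h l).trans_lt ENNReal.ofReal_lt_top
  have hint : Integrable (fun p : S × S => φ p.1 - φ p.2) (Q.prod Q) := by
    refine ((hexp 1).add (hexp (-1))).mono' (by fun_prop) (ae_of_all _ fun p => ?_)
    have h1 := Real.add_one_le_exp (φ p.1 - φ p.2)
    have h2 := Real.add_one_le_exp (-(φ p.1 - φ p.2))
    have h3 := Real.exp_pos (φ p.1 - φ p.2)
    have h4 := Real.exp_pos (-(φ p.1 - φ p.2))
    simp only [Pi.add_apply, one_mul, neg_one_mul, Real.norm_eq_abs]
    exact abs_le.2 ⟨by linarith, by linarith⟩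
  obtain ⟨y, hy⟩ := hint.prod_left_ae.exists
  refine (hy.add (integrable_const (φ y))).congr (ae_of_all _ fun x => ?_)
  simp

/-- Centering at the mean makes the second copy's factor at least 1, by Jensen's inequality in the
form e^x ≥ 1 + x, so that factor can be dropped. -/
theorem SymmetrizedSubgaussian.lintegral_exp_le {φ : S → ℝ} {w : ℝ}
    (h : SymmetrizedSubgaussian Q φ w) (hφ : Measurable φ) (l : ℝ) :
    ∫⁻ x, ENNReal.ofReal (Real.exp (l * (φ x - ∫ y, φ y ∂Q))) ∂Q
      ≤ ENNReal.ofReal (Real.exp (l ^ 2 * w)) := by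
  have hint := h.integrable hφ
  set m := ∫ y, φ y ∂Q
  have h1 : 1 ≤ ∫⁻ y, ENNReal.ofReal (Real.exp (-l * (φ y - m))) ∂Q := by
    by_cases htop : ∫⁻ y, ENNReal.ofReal (Real.exp (-l * (φ y - m))) ∂Q = ∞
    · rw [htop]; exact le_top
    have hexp : Integrable (fun y => Real.exp (-l * (φ y - m))) Q := by
      refine ⟨by fun_prop, ?_⟩
      rw [hasFiniteIntegral_iff_ofReal (ae_of_all _ fun _ => (Real.exp_pos _).le)]
      exact lt_top_iff_ne_top.2 htop
    rw [← ofReal_integral_eq_lintegral_ofReal hexp (ae_of_all _ fun _ => (Real.exp_pos _).le),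
      ENNReal.one_le_ofReal]
    have hlin : ∫ y, (-l * (φ y - m) + 1) ∂Q = 1 := by
      have hint' : Integrable (fun y => φ y - m) Q := hint.sub (integrable_const m)
      rw [integral_add (hint'.const_mul (-l)) (integrable_const 1),
        integral_const_mul, integral_sub hint (integrable_const m)]
      simp [m]
    rw [← hlin]
    exact integral_mono (((hint.sub (integrable_const m)).const_mul (-l)).add (integrable_const 1))
      hexp fun y => Real.add_one_le_exp _
  calc _ ≤ (∫⁻ x, ENNReal.ofReal (Real.exp (l * (φ x - m))) ∂Q)
        * ∫⁻ y, ENNReal.ofReal (Real.exp (-l * (φ y - m))) ∂Q := le_mul_of_one_le_right' h1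
    _ ≤ _ := by rw [← lintegral_exp_prod hφ l m]; exact h l

/-- The Gaussian tail bound. -/
theorem SymmetrizedSubgaussian.measure_abs_le {φ : S → ℝ} {w w' : ℝ}
    (h : SymmetrizedSubgaussian Q φ w) (hφ : Measurable φ) (hw : w ≤ w') (hw' : 0 < w') {a : ℝ}
    (ha : 0 ≤ a) :
    Q {x | a < |φ x - ∫ y, φ y ∂Q|} ≤ ENNReal.ofReal (2 * Real.exp (-a ^ 2 / (4 * w'))) := by
  have hb (l : ℝ) : ENNReal.ofReal (Real.exp (l ^ 2 * w)) ≤ ENNReal.ofReal (Real.exp (l ^ 2 * w')) :=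
    ENNReal.ofReal_le_ofReal (Real.exp_le_exp.2 (mul_le_mul_of_nonneg_left hw (sq_nonneg l)))
  have h1 := measure_lt_le_of_lintegral_exp_le (Q := Q) (ξ := fun x => φ x - ∫ y, φ y ∂Q)
    (by fun_prop) hw' (fun l => (h.lintegral_exp_le hφ l).trans (hb l)) ha
  have h2 := measure_lt_le_of_lintegral_exp_le (Q := Q) (ξ := fun x => -(φ x - ∫ y, φ y ∂Q))
    (by fun_prop) hw' (fun l => by
      have := (h.lintegral_exp_le hφ (-l)).trans (hb (-l))
      simpa only [neg_sq, mul_neg, neg_mul] using this) ha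
  calc Q {x | a < |φ x - ∫ y, φ y ∂Q|}
      ≤ Q ({x | a < φ x - ∫ y, φ y ∂Q} ∪ {x | a < -(φ x - ∫ y, φ y ∂Q)}) :=
        measure_mono fun x hx => by
          simpa only [Set.mem_union, Set.mem_ofPred_eq, lt_abs] using hx
    _ ≤ _ := measure_union_le _ _
    _ ≤ _ := add_le_add h1 h2
    _ = _ := by rw [← ENNReal.ofReal_add (Real.exp_pos _).le (Real.exp_pos _).le, two_mul]

end Symmetrization

/-! ### Dyadic chaining and compact sets in C[0,1]. -/

section Chaining

/-- The dyadic point `k / 2ⁿ`, projected to `[0,1]`. -/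
noncomputable def dyadicPoint (n k : ℕ) : unitInterval :=
  Set.projIcc (0 : ℝ) 1 zero_le_one (k / 2 ^ n)

theorem coe_dyadicPoint {n k : ℕ} (hk : k ≤ 2 ^ n) : (dyadicPoint n k : ℝ) = k / 2 ^ n := by
  have hk' : (k : ℝ) ≤ 2 ^ n := by exact_mod_cast hk
  rw [dyadicPoint, Set.projIcc_of_mem _ ⟨by positivity, by rw [div_le_one (by positivity)]; exact hk'⟩]

theorem dyadicPoint_of_le {n k : ℕ} (hk : 2 ^ n ≤ k) : dyadicPoint n k = 1 := by
  have hk' : (2 : ℝ) ^ n ≤ k := by exact_mod_cast hk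
  exact Set.projIcc_of_right_le _ (by rw [one_le_div (by positivity)]; exact hk')

theorem dyadicPoint_succ_two_mul (n k : ℕ) : dyadicPoint (n + 1) (2 * k) = dyadicPoint n k := by
  unfold dyadicPoint
  congr 1
  push_cast
  rw [pow_succ]
  field_simp

/-- The largest dyadic point of level `n` below `t`. -/
noncomputable def dyadicFloor (n : ℕ) (t : unitInterval) : unitInterval :=
  dyadicPoint n ⌊(t : ℝ) * 2 ^ n⌋₊

theorem tendsto_dyadicFloor (t : unitInterval) :
    Tendsto (fun n => dyadicFloor n t) atTop (𝓝 t) := by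
  have h1 : Tendsto (fun n : ℕ => (⌊(t : ℝ) * 2 ^ n⌋₊ : ℝ) / 2 ^ n) atTop (𝓝 (t : ℝ)) :=
    (tendsto_nat_floor_mul_div_atTop t.2.1).comp (tendsto_pow_atTop_atTop_of_one_lt one_lt_two)
  have h2 := ((continuous_projIcc (h := zero_le_one' ℝ)).tendsto (t : ℝ)).comp h1
  rw [Set.projIcc_val] at h2
  exact h2

/-- `h` moves by at most `a n` between neighbouring dyadic points of level `n`. -/
def DyadicBound (h : unitInterval → ℝ) (a : ℕ → ℝ) : Prop :=
  ∀ n k, |h (dyadicPoint n (k + 1)) - h (dyadicPoint n k)| ≤ a n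

theorem DyadicBound.nonneg {h : unitInterval → ℝ} {a : ℕ → ℝ} (H : DyadicBound h a) (n : ℕ) :
    0 ≤ a n := (abs_nonneg _).trans (H n 0)

/-- ⌊2y⌋ is 2⌊y⌋ or 2⌊y⌋ + 1, so consecutive dyadic floors coincide or are neighbours at the finer
level. -/
theorem DyadicBound.abs_sub_floor_succ_le {h : unitInterval → ℝ} {a : ℕ → ℝ}
    (H : DyadicBound h a) (n : ℕ) (t : unitInterval) :
    |h (dyadicFloor (n + 1) t) - h (dyadicFloor n t)| ≤ a (n + 1) := by
  have ht : 0 ≤ (t : ℝ) * 2 ^ n := mul_nonneg t.2.1 (by positivity)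
  have h0 : (t : ℝ) * 2 ^ (n + 1) = 2 * ((t : ℝ) * 2 ^ n) := by ring
  unfold dyadicFloor
  rw [h0, ← dyadicPoint_succ_two_mul n]
  set y := (t : ℝ) * 2 ^ n
  have h1 : 2 * ⌊y⌋₊ ≤ ⌊2 * y⌋₊ := Nat.le_floor (by
    push_cast
    have := Nat.floor_le ht
    linarith)
  have h2 : ⌊2 * y⌋₊ < 2 * ⌊y⌋₊ + 2 := (Nat.floor_lt (by positivity)).2 (by
    push_cast
    have := Nat.lt_floor_add_one y
    linarith)
  obtain h3 | h3 : ⌊2 * y⌋₊ = 2 * ⌊y⌋₊ ∨ ⌊2 * y⌋₊ = 2 * ⌊y⌋₊ + 1 := by omega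
  · rw [h3, sub_self, abs_zero]
    exact H.nonneg _
  · rw [h3]
    exact H _ _

theorem DyadicBound.abs_sub_floor_floor_le {h : unitInterval → ℝ} {a : ℕ → ℝ}
    (H : DyadicBound h a) {n : ℕ} {s t : unitInterval} (hst : |(t : ℝ) - s| ≤ (1 / 2) ^ n) :
    |h (dyadicFloor n t) - h (dyadicFloor n s)| ≤ a n := by
  wlog hle : s ≤ t generalizing s t
  · rw [abs_sub_comm]
    exact this (by rwa [abs_sub_comm]) (le_of_not_ge hle)
  have hle' : (s : ℝ) ≤ t := hle
  have hst' : (t : ℝ) * 2 ^ n ≤ s * 2 ^ n + 1 := by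
    have h1 : ((t : ℝ) - s) * 2 ^ n ≤ (1 / 2) ^ n * 2 ^ n :=
      mul_le_mul_of_nonneg_right ((le_abs_self _).trans hst) (by positivity)
    rw [← mul_pow] at h1
    norm_num at h1
    linarith
  unfold dyadicFloor
  have h1 : ⌊(s : ℝ) * 2 ^ n⌋₊ ≤ ⌊(t : ℝ) * 2 ^ n⌋₊ := Nat.floor_mono (by gcongr)
  have h2 : ⌊(t : ℝ) * 2 ^ n⌋₊ ≤ ⌊(s : ℝ) * 2 ^ n⌋₊ + 1 := by
    rw [← Nat.floor_add_one (mul_nonneg s.2.1 (by positivity))]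
    exact Nat.floor_mono hst'
  obtain h3 | h3 : ⌊(t : ℝ) * 2 ^ n⌋₊ = ⌊(s : ℝ) * 2 ^ n⌋₊ ∨
      ⌊(t : ℝ) * 2 ^ n⌋₊ = ⌊(s : ℝ) * 2 ^ n⌋₊ + 1 := by omega
  · rw [h3, sub_self, abs_zero]
    exact H.nonneg _
  · rw [h3]
    exact H _ _

/-- A continuous function with geometrically decaying dyadic increments has a geometric modulus
of continuity. -/
theorem DyadicBound.abs_sub_le {h : unitInterval → ℝ} (hc : Continuous h) {r ρ : ℝ} (hρ : ρ < 1)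
    (H : DyadicBound h fun n => r * ρ ^ n) {n : ℕ} {s t : unitInterval}
    (hst : |(t : ℝ) - s| ≤ (1 / 2) ^ n) :
    |h t - h s| ≤ (2 * (r * ρ / (1 - ρ)) + r) * ρ ^ n := by
  have h1 (t : unitInterval) : |h (dyadicFloor n t) - h t| ≤ r * ρ * ρ ^ n / (1 - ρ) := by
    rw [← Real.dist_eq]
    -- The values at the dyadic floors converge to `h t` with geometric steps; the tail of the
    -- series from level `n` bounds the error. The final constant has two such tails and one jump at
    -- level `n`.
    refine dist_le_of_le_geometric_of_tendsto ρ (r * ρ) hρ (fun m => ?_)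
      ((hc.tendsto t).comp (tendsto_dyadicFloor t)) n
    have := H.abs_sub_floor_succ_le m t
    rw [Function.comp_apply, Function.comp_apply, dist_comm, Real.dist_eq]
    refine this.trans_eq ?_
    ring
  have h2 := H.abs_sub_floor_floor_le hst
  have h3 : h t - h s = -(h (dyadicFloor n t) - h t) + (h (dyadicFloor n t) - h (dyadicFloor n s))
      + (h (dyadicFloor n s) - h s) := by ring
  calc |h t - h s| ≤ |h (dyadicFloor n t) - h t| + |h (dyadicFloor n t) - h (dyadicFloor n s)|
      + |h (dyadicFloor n s) - h s| := by
        rw [h3]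
        refine (abs_add_le _ _).trans (add_le_add_left ((abs_add_le _ _).trans ?_) _)
        rw [abs_neg]
    _ ≤ r * ρ * ρ ^ n / (1 - ρ) + r * ρ ^ n + r * ρ * ρ ^ n / (1 - ρ) :=
        add_le_add (add_le_add (h1 t) h2) (h1 s)
    _ = _ := by ring

/-- Continuous functions on `[0,1]` vanishing at `0`, with the modulus of continuity
`C ρⁿ` at the scale `2⁻ⁿ`. -/
def geometricModulusSet (C ρ : ℝ) : Set C(unitInterval, ℝ) :=
  {h | h 0 = 0 ∧ ∀ (n : ℕ) (s t : unitInterval),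
    |(t : ℝ) - s| ≤ (1 / 2) ^ n → |h t - h s| ≤ C * ρ ^ n}

theorem exists_pos_forall_abs_sub_lt {C ρ : ℝ} (hρ : 0 ≤ ρ) (hρ' : ρ < 1) {e : ℝ} (he : 0 < e) :
    ∃ δ > 0, ∀ h : unitInterval → ℝ, (∀ (n : ℕ) (s t : unitInterval),
      |(t : ℝ) - s| ≤ (1 / 2) ^ n → |h t - h s| ≤ C * ρ ^ n) →
      ∀ s t : unitInterval, dist s t < δ → |h t - h s| < e := by
  have h1 : Tendsto (fun n : ℕ => C * ρ ^ n) atTop (𝓝 0) := by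
    simpa using (tendsto_pow_atTop_nhds_zero_of_lt_one hρ hρ').const_mul C
  obtain ⟨n, hn⟩ := (h1.eventually (gt_mem_nhds he)).exists
  refine ⟨(1 / 2) ^ n, by positivity, fun h hh s t hst => (hh n s t ?_).trans_lt hn⟩
  rw [dist_comm, Subtype.dist_eq, Real.dist_eq] at hst
  exact hst.le

theorem isCompact_geometricModulusSet {C ρ : ℝ} (hρ : 0 ≤ ρ) (hρ' : ρ < 1) :
    IsCompact (geometricModulusSet C ρ) := by
  refine ArzelaAscoli.isCompact_of_equicontinuous _ ?_ ?_
  -- The modulus condition already forces continuity, so the set is cut out by pointwise closed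
  -- conditions, inside the compact product of intervals [-C, C].
  · have himage : ContinuousMap.toFun '' geometricModulusSet C ρ
        = {f : unitInterval → ℝ | f 0 = 0 ∧ ∀ (n : ℕ) (s t : unitInterval),
          |(t : ℝ) - s| ≤ (1 / 2) ^ n → |f t - f s| ≤ C * ρ ^ n} := by
      ext f
      constructor
      · rintro ⟨h, hh, rfl⟩
        exact hh
      · intro hf
        have hfc : Continuous f := by
          refine Metric.continuous_iff.2 fun s e he => ?_
          obtain ⟨δ, hδ, H⟩ := exists_pos_forall_abs_sub_lt (C := C) hρ hρ' he
          exact ⟨δ, hδ, fun t ht => by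
            rw [Real.dist_eq]
            exact H f hf.2 s t (by rwa [dist_comm])⟩
        exact ⟨⟨f, hfc⟩, hf, rfl⟩
    rw [himage]
    refine (isCompact_univ_pi fun _ : unitInterval => isCompact_Icc (a := -C) (b := C)).of_isClosed_subset
      ?_ ?_
    · simp only [Set.ofPred_and, Set.ofPred_forall]
      refine (isClosed_eq (by fun_prop) (by fun_prop)).inter ?_
      exact isClosed_iInter fun n => isClosed_iInter fun s => isClosed_iInter fun t =>
        isClosed_iInter fun _ => isClosed_le (by fun_prop) (by fun_prop)
    · rintro f ⟨hf0, hf⟩ t -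
      -- Scale n = 0 and base point s = 0 give |f t| ≤ C.
      have := hf 0 0 t (by
        have h1 : (t : ℝ) - (0 : unitInterval) = t := by simp
        rw [h1, abs_of_nonneg t.2.1]
        simpa using t.2.2)
      rw [hf0, sub_zero, pow_zero, mul_one] at this
      exact abs_le.1 this
  · intro s
    refine Metric.equicontinuousAt_iff.2 fun e he => ?_
    obtain ⟨δ, hδ, H⟩ := exists_pos_forall_abs_sub_lt (C := C) hρ hρ' he
    refine ⟨δ, hδ, fun t ht h => ?_⟩
    rw [dist_comm, Real.dist_eq]
    exact H h h.2.2 s t (by rwa [dist_comm])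

end Chaining

/-! ### Union bound and exponential tightness. -/

section Tightness

/-- With q^k > 4, the bound e^x ≥ x^k / k! at x = q^n gives e^(q^n) ≥ 4^n / k!, so the terms are at
most k! 2^(-n). -/
theorem summable_two_pow_mul_exp_neg_pow {q : ℝ} (hq : 1 < q) :
    Summable fun n : ℕ => (2 : ℝ) ^ n * Real.exp (-q ^ n) := by
  obtain ⟨k, hk⟩ := pow_unbounded_of_one_lt 4 hq
  have hq0 : 0 < q := one_pos.trans hq
  refine Summable.of_nonneg_of_le (fun n => by positivity) (fun n => ?_)
    ((summable_geometric_two).mul_left (k.factorial : ℝ))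
  have h1 : (q ^ n) ^ k / k.factorial ≤ Real.exp (q ^ n) :=
    Real.pow_div_factorial_le_exp _ (by positivity) k
  have h2 : (4 : ℝ) ^ n ≤ (q ^ n) ^ k := by
    rw [← pow_mul, mul_comm, pow_mul]
    exact pow_le_pow_left₀ (by norm_num) hk.le n
  have h3 : (4 : ℝ) ^ n / k.factorial ≤ Real.exp (q ^ n) := le_trans (by gcongr) h1
  have hf : (0 : ℝ) < k.factorial := by exact_mod_cast k.factorial_pos
  rw [Real.exp_neg, ← div_eq_mul_inv, div_le_iff₀ (Real.exp_pos _)]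
  calc (2 : ℝ) ^ n = k.factorial * (1 / 2) ^ n * ((4 : ℝ) ^ n / k.factorial) := by
        field_simp
        rw [← mul_pow]
        norm_num
    _ ≤ _ := by gcongr

/-- The union bound behind chaining: the probability that some dyadic increment is large. -/
theorem measure_not_dyadicBound_le {S : Type*} [MeasurableSpace S] {Q : Measure S}
    {U : S → unitInterval → ℝ} {a : ℕ → ℝ} (ha : ∀ n, 0 ≤ a n) {A q : ℝ} (hA : 1 ≤ A) (hq : 1 < q)
    (hU : ∀ n k, k < 2 ^ n → Q {x | a n < |U x (dyadicPoint n (k + 1)) - U x (dyadicPoint n k)|}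
      ≤ ENNReal.ofReal (2 * Real.exp (-(A * q ^ n)))) :
    Q {x | ¬ DyadicBound (U x) a} ≤ ENNReal.ofReal
      ((∑' n : ℕ, 2 * ((2 : ℝ) ^ n * Real.exp (-q ^ n))) * Real.exp (-(A - 1))) := by
  have hsub : {x | ¬ DyadicBound (U x) a} ⊆ ⋃ n : ℕ, ⋃ k ∈ Finset.range (2 ^ n),
      {x | a n < |U x (dyadicPoint n (k + 1)) - U x (dyadicPoint n k)|} := by
    intro x hx
    simp only [DyadicBound, Set.mem_ofPred_eq, not_forall, not_le] at hx
    obtain ⟨n, k, hnk⟩ := hx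
    simp only [Set.mem_iUnion, Finset.mem_range, Set.mem_ofPred_eq]
    refine ⟨n, k, ?_, hnk⟩
    by_contra! hk
    -- Beyond the right end both dyadic points are clamped to 1, so the increment vanishes.
    rw [dyadicPoint_of_le hk, dyadicPoint_of_le (hk.trans k.le_succ), sub_self, abs_zero] at hnk
    exact absurd hnk (ha n).not_gt
  have hsum := (summable_two_pow_mul_exp_neg_pow hq).mul_left 2
  calc _ ≤ _ := measure_mono hsub
    _ ≤ ∑' n : ℕ, Q (⋃ k ∈ Finset.range (2 ^ n),
        {x | a n < |U x (dyadicPoint n (k + 1)) - U x (dyadicPoint n k)|}) := measure_iUnion_le _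
    _ ≤ ∑' n : ℕ, ENNReal.ofReal
        (2 * ((2 : ℝ) ^ n * Real.exp (-q ^ n)) * Real.exp (-(A - 1))) := by
      refine ENNReal.tsum_le_tsum fun n => ?_
      calc _ ≤ ∑ k ∈ Finset.range (2 ^ n), Q {x | a n <
            |U x (dyadicPoint n (k + 1)) - U x (dyadicPoint n k)|} := measure_biUnion_finset_le _ _
        _ ≤ ∑ k ∈ Finset.range (2 ^ n), ENNReal.ofReal (2 * Real.exp (-(A * q ^ n))) :=
          Finset.sum_le_sum fun k hk => hU n k (Finset.mem_range.1 hk)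
        _ = ENNReal.ofReal (2 ^ n * (2 * Real.exp (-(A * q ^ n)))) := by
          rw [Finset.sum_const, Finset.card_range, nsmul_eq_mul,
            ENNReal.ofReal_mul (by positivity : (0 : ℝ) ≤ 2 ^ n)]
          congr 1
          rw [ENNReal.ofReal_pow (by norm_num)]
          simp
        _ ≤ _ := by
          refine ENNReal.ofReal_le_ofReal ?_
          -- A q^n ≥ q^n + (A - 1), because (A - 1)(q^n - 1) ≥ 0. This splits off the decay in `A`
          -- from a series that does not involve `A`.
          have h1 : Real.exp (-(A * q ^ n)) ≤ Real.exp (-q ^ n) * Real.exp (-(A - 1)) := by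
            rw [← Real.exp_add]
            refine Real.exp_le_exp.2 ?_
            have := one_le_pow₀ hq.le (n := n)
            nlinarith
          have h2 : (0 : ℝ) < 2 ^ n := by positivity
          nlinarith
    _ = _ := by
      rw [← ENNReal.ofReal_tsum_of_nonneg (fun n => by positivity) (hsum.mul_right _),
        tsum_mul_right]

/-- Exponential tightness from Gaussian tails of the increments. -/
theorem isExponentiallyTight_of_measure_increment_le {S : Type*} [MeasurableSpace S]
    {Q : Measure S} {U : ℝ≥0 → S → unitInterval → ℝ} {γ : ℝ≥0 → ℝ} (hγ_pos : ∀ ε, 0 < ε → 0 < γ ε)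
    (hγ_lim : Tendsto γ (𝓝[>] 0) (𝓝 0)) {M τ : ℝ} (hM : 0 < M) (hτ : 0 < τ)
    (hc : ∀ ε x, Continuous (U ε x)) (h0 : ∀ ε x, U ε x 0 = 0)
    (hU : ∀ᶠ ε : ℝ≥0 in 𝓝[>] 0, ∀ s t : unitInterval, s ≠ t → ∀ a : ℝ, 0 ≤ a →
      Q {x | a < |U ε x t - U ε x s|} ≤ ENNReal.ofReal
        (2 * Real.exp (-a ^ 2 / (4 * (M * (γ ε ^ 2 * |(t : ℝ) - s| ^ (2 * τ))))))) :
    IsExponentiallyTight Q U (fun ε => γ ε ^ 2) := by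
  intro R hR
  -- At scale 2^(-n) the variance bound is M γ² ρ^(4n). Thresholds r ρ^n therefore decay slower than
  -- the standard deviation, by a factor ρ^(-n), whence q = ρ^(-2); r² = 4MR makes the exponent
  -- exactly -(R/γ²) q^n.
  set ρ : ℝ := (1 / 2 : ℝ) ^ (τ / 2) with hρ_def
  have hρ : 0 < ρ := by positivity
  have hρ1 : ρ < 1 := Real.rpow_lt_one (by norm_num) (by norm_num) (by positivity)
  set q : ℝ := (ρ ^ 2)⁻¹ with hq_def
  have hq : 1 < q := (one_lt_inv₀ (by positivity)).2 (pow_lt_one₀ hρ.le hρ1 two_ne_zero)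
  set r : ℝ := Real.sqrt (4 * M * R) with hr_def
  have hr : r ^ 2 = 4 * M * R := Real.sq_sqrt (by positivity)
  set C : ℝ := ∑' n : ℕ, 2 * ((2 : ℝ) ^ n * Real.exp (-q ^ n)) with hC_def
  have hC : 0 < C := ((summable_two_pow_mul_exp_neg_pow hq).mul_left 2).tsum_pos
    (fun n => by positivity) 0 (by positivity)
  refine ⟨geometricModulusSet (2 * (r * ρ / (1 - ρ)) + r) ρ,
    isCompact_geometricModulusSet hρ.le hρ1, ?_⟩
  have hγ2 : Tendsto (fun ε => γ ε ^ 2) (𝓝[>] 0) (𝓝 0) := by simpa using hγ_lim.pow 2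
  have hev : ∀ᶠ ε : ℝ≥0 in 𝓝[>] 0,
      ((γ ε ^ 2 : ℝ) : EReal) * ENNReal.log (Q {x | ¬ ∃ h ∈ geometricModulusSet
        (2 * (r * ρ / (1 - ρ)) + r) ρ, ⇑h = U ε x})
      ≤ ((γ ε ^ 2 * (Real.log C + 1) - R : ℝ) : EReal) := by
    filter_upwards [hU, hγ2.eventually (gt_mem_nhds hR), self_mem_nhdsWithin] with ε hUε hγR hε
    have hγε : 0 < γ ε := hγ_pos ε hε
    set A : ℝ := R / γ ε ^ 2 with hA_def
    have hA : 1 ≤ A := by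
      rw [hA_def, one_le_div (by positivity)]
      exact hγR.le
    have hsub : {x | ¬ ∃ h ∈ geometricModulusSet (2 * (r * ρ / (1 - ρ)) + r) ρ, ⇑h = U ε x}
        ⊆ {x | ¬ DyadicBound (U ε x) fun n => r * ρ ^ n} := by
      intro x hx hd
      exact hx ⟨⟨U ε x, hc ε x⟩, ⟨h0 ε x, fun n s t hst => hd.abs_sub_le (hc ε x) hρ1 hst⟩, rfl⟩
    have hb := measure_not_dyadicBound_le (Q := Q) (U := U ε) (a := fun n => r * ρ ^ n)
      (fun n => by positivity) hA hq (fun n k hk => by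
        have hs := coe_dyadicPoint hk.le
        have ht := coe_dyadicPoint (Nat.succ_le_of_lt hk)
        have hts : ((dyadicPoint n (k + 1) : ℝ) - dyadicPoint n k) = (1 / 2) ^ n := by
          rw [hs, ht]
          push_cast
          rw [one_div, inv_pow]
          ring
        have hne : dyadicPoint n k ≠ dyadicPoint n (k + 1) := by
          intro h
          rw [h, sub_self] at hts
          exact absurd hts (by positivity)
        refine (hUε _ _ hne _ (by positivity)).trans_eq ?_
        rw [hts, abs_of_pos (by positivity)]
        have hpow : (((1 : ℝ) / 2) ^ n) ^ (2 * τ) = ρ ^ (4 * n) := by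
          rw [hρ_def, ← Real.rpow_natCast, ← Real.rpow_natCast, ← Real.rpow_mul (by norm_num),
            ← Real.rpow_mul (by norm_num)]
          push_cast
          ring_nf
        rw [hpow]
        congr 3
        rw [mul_pow, hr, hA_def, hq_def, inv_pow]
        have : ρ ^ (4 * n) = ρ ^ n * ρ ^ n * (ρ ^ 2) ^ n := by ring
        rw [this]
        field_simp)
    have hlog : ENNReal.log (Q {x | ¬ ∃ h ∈ geometricModulusSet
        (2 * (r * ρ / (1 - ρ)) + r) ρ, ⇑h = U ε x})
        ≤ ((Real.log C - (A - 1) : ℝ) : EReal) := by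
      refine (ENNReal.log_monotone ((measure_mono hsub).trans hb)).trans_eq ?_
      rw [ENNReal.log_ofReal, if_neg (not_le.2 (by positivity)),
        Real.log_mul hC.ne' (Real.exp_ne_zero _), Real.log_exp, ← sub_eq_add_neg]
    refine (mul_le_mul_of_nonneg_left hlog (EReal.coe_nonneg.2 (sq_nonneg _))).trans_eq ?_
    rw [← EReal.coe_mul]
    congr 1
    rw [hA_def]
    field_simp
    ring
  have hlim : Tendsto (fun ε => ((γ ε ^ 2 * (Real.log C + 1) - R : ℝ) : EReal)) (𝓝[>] 0)
      (𝓝 ((-R : ℝ) : EReal)) := by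
    have : Tendsto (fun ε => γ ε ^ 2 * (Real.log C + 1) - R) (𝓝[>] 0) (𝓝 (-R)) := by
      simpa using (hγ2.mul_const (Real.log C + 1)).sub_const R
    exact (continuous_coe_real_ereal.tendsto _).comp this
  have hle := limsup_le_limsup hev
  rw [hlim.limsup_eq] at hle
  exact hle

end Tightness

/-! ### From countably many pairs of times to all, and continuity of the conditional mean. -/

section Paths

variable [MeasurableSpace C(ℝ≥0, ℝ)] {Q : Measure C(ℝ≥0, ℝ)}

/-- Discontinuous paths count as outside every compact set, so continuity of the subtracted mean is
essential. -/
theorem continuous_centeredIncrement {T : ℝ≥0}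
    (h : Continuous fun t => ∫ x, (x t - x T) ∂Q) (ε : ℝ≥0) (x : C(ℝ≥0, ℝ)) :
    Continuous (centeredIncrement Q T ε x) := by
  have h1 : Continuous fun t : unitInterval => T + ε * unitInterval.toNNReal t := by
    have := unitInterval.toNNReal_continuous
    fun_prop
  exact ((x.continuous.comp h1).sub continuous_const).sub (h.comp h1)

theorem centeredIncrement_zero (T ε : ℝ≥0) (x : C(ℝ≥0, ℝ)) : centeredIncrement Q T ε x 0 = 0 := by
  simp [centeredIncrement]

variable [BorelSpace C(ℝ≥0, ℝ)]

theorem measurable_continuousMap_eval (t : ℝ≥0) : Measurable fun x : C(ℝ≥0, ℝ) => x t :=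
  (continuous_eval_const t).measurable

theorem symmetrizedSubgaussian_increment_of_dense {w : ℝ≥0 × ℝ≥0 → ℝ} (hw : Continuous w)
    {D : Set (ℝ≥0 × ℝ≥0)} (hD : Dense D)
    (h : ∀ d ∈ D, SymmetrizedSubgaussian Q (fun x => x d.1 - x d.2) (w d)) (d : ℝ≥0 × ℝ≥0) :
    SymmetrizedSubgaussian Q (fun x => x d.1 - x d.2) (w d) := by
  obtain ⟨u, huD, hu⟩ := mem_closure_iff_seq_limit.1 (hD d)
  refine SymmetrizedSubgaussian.of_tendsto (φ := fun n x => x (u n).1 - x (u n).2)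
    (fun n => (measurable_continuousMap_eval _).sub (measurable_continuousMap_eval _))
    (fun n => h _ (huD n)) (fun x => ?_) ((hw.tendsto d).comp hu)
  have hc : Continuous fun p : ℝ≥0 × ℝ≥0 => x p.1 - x p.2 := by fun_prop
  exact (hc.tendsto d).comp hu

variable [IsProbabilityMeasure Q]

/-- With probability above 1/2 the path moves by less than δ, and with probability above 1/2 the
increment is within δ of its mean. Some path does both, so the mean increment is below 2δ. -/
theorem continuous_integral_increment {w : ℝ≥0 × ℝ≥0 → ℝ} (hw : Continuous w)
    (hw0 : ∀ t, w (t, t) = 0)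
    (h : ∀ d : ℝ≥0 × ℝ≥0, SymmetrizedSubgaussian Q (fun x => x d.1 - x d.2) (w d)) (T : ℝ≥0) :
    Continuous fun t => ∫ x, (x t - x T) ∂Q := by
  have hm (d : ℝ≥0 × ℝ≥0) : Measurable fun x : C(ℝ≥0, ℝ) => x d.1 - x d.2 :=
    (measurable_continuousMap_eval _).sub (measurable_continuousMap_eval _)
  refine continuous_iff_seqContinuous.2 fun u t hu => ?_
  rw [Metric.tendsto_atTop']
  intro e he
  set δ := e / 3
  have hδ : 0 < δ := by positivity
  have hmeas : TendstoInMeasure Q (fun n (x : C(ℝ≥0, ℝ)) => x (u n)) atTop fun x => x t :=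
    tendstoInMeasure_of_tendsto_ae
      (fun n => (measurable_continuousMap_eval _).aestronglyMeasurable)
      (ae_of_all _ fun x => (x.continuous.tendsto t).comp hu)
  have h1 : ∀ᶠ n in atTop, Q {x | δ ≤ dist (x (u n)) (x t)} < 1 / 2 :=
    (tendstoInMeasure_iff_dist.1 hmeas δ hδ).eventually (gt_mem_nhds (by simp))
  have hwu : Tendsto (fun n => w (u n, t)) atTop (𝓝 0) := by
    rw [← hw0 t]
    exact (hw.tendsto (t, t)).comp (hu.prodMk_nhds tendsto_const_nhds)
  -- The value δ²/8 makes the tail bound at δ equal to 2 e^(-2) < 1/2.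
  have h2 : ∀ᶠ n in atTop, w (u n, t) < δ ^ 2 / 8 :=
    hwu.eventually (gt_mem_nhds (by positivity))
  obtain ⟨N, hN⟩ := eventually_atTop.1 (h1.and h2)
  refine ⟨N, fun n hn => ?_⟩
  obtain ⟨h1, h2⟩ := hN n hn.le
  have h3 := (h (u n, t)).measure_abs_le (hm _) h2.le (by positivity) hδ.le
  have h4 : ENNReal.ofReal (2 * Real.exp (-δ ^ 2 / (4 * (δ ^ 2 / 8)))) < 1 / 2 := by
    have : -δ ^ 2 / (4 * (δ ^ 2 / 8)) = -2 := by field_simp; norm_num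
    rw [this, one_div, ← ENNReal.ofReal_ofNat, ← ENNReal.ofReal_inv_of_pos (by norm_num)]
    rw [ENNReal.ofReal_lt_ofReal_iff (by norm_num)]
    have h5 : (4 : ℝ) < Real.exp 2 := by
      have h6 := Real.exp_one_gt_d9
      have h7 : Real.exp 2 = Real.exp 1 * Real.exp 1 := by rw [← Real.exp_add]; norm_num
      nlinarith
    rw [Real.exp_neg, ← div_eq_mul_inv, div_lt_iff₀ (Real.exp_pos _)]
    norm_num
    linarith
  have h5 : Q ({x | δ ≤ dist (x (u n)) (x t)} ∪
      {x | δ < |x (u n) - x t - ∫ y, (y (u n) - y t) ∂Q|}) < 1 := by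
    refine (measure_union_le _ _).trans_lt ?_
    rw [← ENNReal.add_halves 1]
    exact ENNReal.add_lt_add h1 (h3.trans_lt h4)
  obtain ⟨x, hx⟩ : ∃ x : C(ℝ≥0, ℝ), x ∉ ({x | δ ≤ dist (x (u n)) (x t)} ∪
      {x | δ < |x (u n) - x t - ∫ y, (y (u n) - y t) ∂Q|}) := by
    by_contra! hall
    rw [Set.eq_univ_of_forall hall, measure_univ] at h5
    exact lt_irrefl _ h5
  simp only [Set.mem_union, Set.mem_ofPred_eq, not_or, not_le, not_lt, Real.dist_eq] at hx
  have hdiff : ∫ y, (y (u n) - y t) ∂Q = ∫ y, (y (u n) - y T) ∂Q - ∫ y, (y t - y T) ∂Q := by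
    rw [← integral_sub ((h (u n, T)).integrable (hm _)) ((h (t, T)).integrable (hm _))]
    exact integral_congr_ae (ae_of_all _ fun y => by simp)
  rw [Function.comp_apply, Real.dist_eq, ← hdiff]
  have h6 := abs_sub_abs_le_abs_sub (∫ y, (y (u n) - y t) ∂Q) (x (u n) - x t)
  rw [abs_sub_comm _ (x (u n) - x t)] at h6
  have h7 : δ = e / 3 := rfl
  linarith [hx.1, hx.2]

end Paths

/-! ### Conditional increments of the Volterra process. -/

section Volterra

variable {Ω : Type*} [MeasurableSpace Ω] {P : Measure Ω}

/-- The variance of the increments of a continuous centered Gaussian process is continuous. -/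
theorem continuous_variance_increment {X : Ω → C(ℝ≥0, ℝ)}
    (hX : IsGaussianProcess (fun t ω => X ω t) P) (h0 : ∀ t, ∫ ω, X ω t ∂P = 0) :
    Continuous fun d : ℝ≥0 × ℝ≥0 => Var[fun ω => X ω d.1 - X ω d.2; P] := by
  have := hX.isProbabilityMeasure
  have hg (d : ℝ≥0 × ℝ≥0) : HasGaussianLaw (fun ω => X ω d.1 - X ω d.2) P :=
    hX.hasGaussianLaw_fun_sub
  have hcf (d : ℝ≥0 × ℝ≥0) : charFun (P.map fun ω => X ω d.1 - X ω d.2) 1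
      = Complex.exp ((-(Var[fun ω => X ω d.1 - X ω d.2; P] / 2) : ℝ) : ℂ) := by
    have hm : ∫ ω, (X ω d.1 - X ω d.2) ∂P = 0 := by
      rw [integral_sub (hX.hasGaussianLaw_eval d.1).integrable
        (hX.hasGaussianLaw_eval d.2).integrable, h0, h0, sub_zero]
    rw [(hg d).map_eq_gaussianReal, hm, charFun_gaussianReal,
      Real.coe_toNNReal _ (variance_nonneg _ _)]
    push_cast
    congr 1
    ring
  have hc : Continuous fun d : ℝ≥0 × ℝ≥0 => charFun (P.map fun ω => X ω d.1 - X ω d.2) 1 := by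
    simp_rw [charFun_map_eq_integral (hg _).aemeasurable]
    refine continuous_of_dominated (bound := fun _ => 1) (fun d => ?_)
      (fun d => ae_of_all _ fun ω => ?_) (integrable_const _) (ae_of_all _ fun ω => ?_)
    · have := (hg d).aemeasurable
      exact AEMeasurable.aestronglyMeasurable (by fun_prop)
    · rw [← Complex.ofReal_mul, Complex.norm_exp_ofReal_mul_I]
    · fun_prop
  -- For a centered Gaussian the characteristic function at 1 is exp(-Var/2); its continuity in the
  -- times follows from that of the paths.
  have heq : (fun d : ℝ≥0 × ℝ≥0 => Var[fun ω => X ω d.1 - X ω d.2; P])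
      = fun d => -2 * Real.log ‖charFun (P.map fun ω => X ω d.1 - X ω d.2) 1‖ := by
    funext d
    rw [hcf, Complex.norm_exp, Complex.ofReal_re, Real.log_exp]
    ring
  rw [heq]
  refine continuous_const.mul (hc.norm.log fun d => ?_)
  rw [hcf]
  exact norm_ne_zero_iff.2 (Complex.exp_ne_zero _)

/-- Wiener integrals lie in the closed span of the driving process. -/
theorem IsWienerIntegral.mem_closure_span {B : ℝ≥0 → Ω → ℝ} {T : ℝ≥0} {f : ℝ → ℝ} {Y : Ω → ℝ}
    (h : IsWienerIntegral P B T f Y) (hY : MemLp Y 2 P) {Z : ℝ≥0 → Lp ℝ 2 P}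
    (hZ : ∀ t, Z t =ᵐ[P] B t) :
    hY.toLp Y ∈ (Submodule.span ℝ (Set.range Z)).topologicalClosure := by
  obtain ⟨g, -, hg⟩ := h
  refine mem_closure_of_tendsto (f := fun n => ((g n).sum fun t a => a • Z t : Lp ℝ 2 P))
    (b := atTop) ?_ (Eventually.of_forall fun n =>
      Finsupp.mem_span_range_iff_exists_finsupp.2 ⟨g n, rfl⟩)
  rw [Lp.tendsto_Lp_iff_tendsto_eLpNorm]
  refine hg.congr fun n => ?_
  rw [eLpNorm_sub_comm]
  refine eLpNorm_congr_ae ?_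
  filter_upwards [coeFn_finsupp_sum_smul hZ (g n)] with ω hω
  rw [Pi.sub_apply, hω]
  rfl

/-- Given the past of the mixed motion, the increments of the Volterra process are, up to
centering, Gaussian with at most the unconditional variance. -/
theorem ae_symmetrizedSubgaussian_increment [IsProbabilityMeasure P]
    [MeasurableSpace C(ℝ≥0, ℝ)] [BorelSpace C(ℝ≥0, ℝ)]
    {B B' : ℝ≥0 → Ω → ℝ} (hB : IsBrownianReal B P) (hB' : IsBrownianReal B' P)
    (hBB' : IndepFun (fun ω t => B t ω) (fun ω t => B' t ω) P)
    {K : ℝ → ℝ → ℝ} {X : Ω → C(ℝ≥0, ℝ)} (hX : IsVolterraProcess P B K X)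
    {α α' : ℝ} {T : ℝ≥0} {κ : Kernel (Set.Iic T → ℝ) C(ℝ≥0, ℝ)} [IsMarkovKernel κ]
    (hκ : HasCondDistrib X (mixedPast B B' α α' T) κ P) (d : ℝ≥0 × ℝ≥0) :
    ∀ᵐ ψ ∂(P.map (mixedPast B B' α α' T)),
      SymmetrizedSubgaussian (κ ψ) (fun x => x d.1 - x d.2)
        Var[fun ω => X ω d.1 - X ω d.2; P] := by
  have hmB (t : ℝ≥0) : MemLp (B t) 2 P := (hB.isGaussianProcess.hasGaussianLaw_eval t).memLp_two
  have hmB' (t : ℝ≥0) : MemLp (B' t) 2 P :=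
    (hB'.isGaussianProcess.hasGaussianLaw_eval t).memLp_two
  have hmX (t : ℝ≥0) : MemLp (fun ω => X ω t) 2 P := (hX.gaussian.hasGaussianLaw_eval t).memLp_two
  let Z (t : ℝ≥0) : Lp ℝ 2 P := (hmB t).toLp
  let Z' (t : ℝ≥0) : Lp ℝ 2 P := (hmB' t).toLp
  have hZ (t : ℝ≥0) : Z t =ᵐ[P] B t := (hmB t).coeFn_toLp
  have hZ' (t : ℝ≥0) : Z' t =ᵐ[P] B' t := (hmB' t).coeFn_toLp
  let H₀ := Submodule.span ℝ (Set.range Z) ⊔ Submodule.span ℝ (Set.range Z')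
  have hH := (isGaussianSpace_span_sup_span hB.isGaussianProcess hB'.isGaussianProcess
    hB.integral_eval hB'.integral_eval hBB' hZ hZ').topologicalClosure
  have hZH (t : ℝ≥0) : Z t ∈ H₀.topologicalClosure :=
    H₀.le_topologicalClosure (le_sup_left (α := Submodule ℝ (Lp ℝ 2 P))
      (Submodule.subset_span ⟨t, rfl⟩))
  have hZH' (t : ℝ≥0) : Z' t ∈ H₀.topologicalClosure :=
    H₀.le_topologicalClosure (le_sup_right (α := Submodule ℝ (Lp ℝ 2 P))
      (Submodule.subset_span ⟨t, rfl⟩))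
  -- The horizon t + 1 is positive even when t = 0.
  have hXH (t : ℝ≥0) : (hmX t).toLp ∈ H₀.topologicalClosure :=
    Submodule.topologicalClosure_mono le_sup_left
      ((hX.representation (t + 1) (by positivity) t (by simp)).mem_closure_span (hmX t) hZ)
  let Y : Lp ℝ 2 P := (hmX d.1).toLp - (hmX d.2).toLp
  have hYH : Y ∈ H₀.topologicalClosure := Submodule.sub_mem _ (hXH _) (hXH _)
  have hY : Y =ᵐ[P] fun ω => X ω d.1 - X ω d.2 := by
    filter_upwards [Lp.coeFn_sub (hmX d.1).toLp (hmX d.2).toLp, (hmX d.1).coeFn_toLp,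
      (hmX d.2).coeFn_toLp] with ω h1 h2 h3
    rw [h1, Pi.sub_apply, h2, h3]
  -- The decomposition needs a measurable observation; the past is replaced by a measurable version
  -- with the same law.
  let V := hκ.aemeasurable_fst.mk
  have hV : Measurable V := hκ.aemeasurable_fst.measurable_mk
  have hVae : mixedPast B B' α α' T =ᵐ[P] V := hκ.aemeasurable_fst.ae_eq_mk
  have hκV : HasCondDistrib X V κ P := by
    unfold HasCondDistrib at hκ ⊢
    rw [← Measure.map_congr hVae]
    refine hκ.congr ?_
    filter_upwards [hVae] with ω hω
    rw [hω]
  rw [Measure.map_congr hVae]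
  have hW (s : Set.Iic T) : (α • Z s + α' • Z' s : Lp ℝ 2 P) =ᵐ[P] fun ω => V ω s := by
    filter_upwards [Lp.coeFn_add (α • Z s) (α' • Z' s), Lp.coeFn_smul α (Z s),
      Lp.coeFn_smul α' (Z' s), hZ s, hZ' s, hVae] with ω h1 h2 h3 h4 h5 h6
    rw [← h6, h1, Pi.add_apply, h2, h3, Pi.smul_apply, Pi.smul_apply, h4, h5]
    rfl
  obtain ⟨f, hf, v, hv, hlaw, hind⟩ := hH.exists_decomposition
    H₀.isClosed_topologicalClosure hV
    (fun s => Submodule.add_mem _ (Submodule.smul_mem _ α (hZH s))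
      (Submodule.smul_mem _ α' (hZH' s))) hW hYH
  have hYf : (fun ω => Y ω - f (V ω)) =ᵐ[P] fun ω => (X ω d.1 - X ω d.2) - f (V ω) := by
    filter_upwards [hY] with ω hω
    rw [hω]
  have hφ : Measurable fun x : C(ℝ≥0, ℝ) => x d.1 - x d.2 :=
    (measurable_continuousMap_eval _).sub (measurable_continuousMap_eval _)
  have hvar : (v : ℝ) ≤ Var[fun ω => X ω d.1 - X ω d.2; P] := by
    rw [← variance_congr hY, variance_of_integral_eq_zero (hH.hasGaussianLaw hYH).aemeasurable
      (hH.integral_eq_zero hYH), Lp_two_integral_sq]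
    exact_mod_cast hv
  filter_upwards [hκV.map_sub_ae_eq hφ hf (hind.congr (ae_eq_refl _) hYf)] with ψ hψ
  rw [← Measure.map_congr hYf, hlaw] at hψ
  exact symmetrizedSubgaussian_of_map_sub_eq hφ hvar hψ

end Volterra

/-! ### Exponential tightness for almost every past. -/

theorem proposition4p2 {Ω : Type*} [MeasurableSpace Ω] (P : Measure Ω) [IsProbabilityMeasure P]
    [MeasurableSpace C(ℝ≥0, ℝ)] [BorelSpace C(ℝ≥0, ℝ)]
    -- two independent Brownian motions
    (B B' : ℝ≥0 → Ω → ℝ) (hB : IsBrownianReal B P) (hB' : IsBrownianReal B' P)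
    (hBB' : IndepFun (fun ω t => B t ω) (fun ω t => B' t ω) P)
    -- the continuous Volterra process
    (K : ℝ → ℝ → ℝ) (X : Ω → C(ℝ≥0, ℝ)) (hX : IsVolterraProcess P B K X)
    -- any version of the regular conditional law of X given the past of the mixed motion up to T
    (α α' : ℝ) (T : ℝ≥0) (hT : 0 < T)
    (κ : Kernel (Set.Iic T → ℝ) C(ℝ≥0, ℝ)) [IsMarkovKernel κ]
    (hκ : HasCondDistrib X (mixedPast B B' α α' T) κ P)
    -- the infinitesimal function and the two bounds
    (γ : ℝ≥0 → ℝ) (hγ_pos : ∀ ε, 0 < ε → 0 < γ ε) (hγ_lim : Tendsto γ (𝓝[>] 0) (𝓝 0))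
    (hvar : IncrementVarianceBound P X γ T) (hker : KernelIncrementBound K γ T) :
    ∀ᵐ ψ ∂(P.map (mixedPast B B' α α' T)),
      IsExponentiallyTight (κ ψ) (centeredIncrement (κ ψ) T) (fun ε => γ ε ^ 2) := by
  obtain ⟨M, τ, hM, hτ, hvar⟩ := hvar
  obtain ⟨D, hDc, hD⟩ := TopologicalSpace.exists_countable_dense (ℝ≥0 × ℝ≥0)
  have hcont := continuous_variance_increment hX.gaussian hX.centered
  have hae := (ae_ball_iff hDc).2 fun d _ =>
    ae_symmetrizedSubgaussian_increment hB hB' hBB' hX hκ d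
  filter_upwards [hae] with ψ hψ
  have hsub := symmetrizedSubgaussian_increment_of_dense hcont hD hψ
  have hmean := continuous_integral_increment hcont
    (fun t => by simp only [sub_self]; exact variance_zero P) hsub
  refine isExponentiallyTight_of_measure_increment_le hγ_pos hγ_lim hM hτ
    (continuous_centeredIncrement (hmean T)) (centeredIncrement_zero T) ?_
  filter_upwards [hvar, self_mem_nhdsWithin] with ε hε hε0 s t hst a ha
  have hpos : 0 < γ ε ^ 2 * |(t : ℝ) - s| ^ (2 * τ) := by
    have h1 : 0 < γ ε := hγ_pos ε hε0
    have h2 : 0 < |(t : ℝ) - s| := abs_pos.2 (sub_ne_zero.2 fun h => hst (Subtype.ext h.symm))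
    positivity
  have hm (t : ℝ≥0) := measurable_continuousMap_eval t
  have hle := (div_le_iff₀ hpos).1 (hε s t hst)
  set u := T + ε * unitInterval.toNNReal t
  set v := T + ε * unitInterval.toNNReal s
  have hint (t : ℝ≥0) : Integrable (fun x : C(ℝ≥0, ℝ) => x t - x T) (κ ψ) :=
    (hsub (t, T)).integrable ((hm _).sub (hm _))
  -- The base time `T` cancels, so increments of U^ε are increments of the path centered at their
  -- own conditional mean.
  have hdiff : ∫ y, (y u - y v) ∂(κ ψ) = ∫ y, (y u - y T) ∂(κ ψ) - ∫ y, (y v - y T) ∂(κ ψ) := by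
    rw [← integral_sub (hint u) (hint v)]
    exact integral_congr_ae (ae_of_all _ fun y => by simp)
  have hb := (hsub (u, v)).measure_abs_le ((hm _).sub (hm _)) hle (by positivity) ha
  refine le_trans (le_of_eq ?_) hb
  congr 1
  ext x
  have : centeredIncrement (κ ψ) T ε x t - centeredIncrement (κ ψ) T ε x s
      = x u - x v - ∫ y, (y u - y v) ∂(κ ψ) := by
    rw [hdiff]
    simp only [centeredIncrement, u, v]
    ring
  rw [Set.mem_ofPred_eq, Set.mem_ofPred_eq, this]
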